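/- Let $k$ be a field and let $K$ be an arbitrary commutative associative $k$-algebra with unit. By a non-associative $K$-algebra we mean a (unital) $K$-module $A$ with a $K$-bilinear multiplication $A\times A\to A$, not assumed to be associative, commutative or unital. A subset $X\subseteq A$ generates $A$ if no proper $K$-submodule of $A$ closed under multiplication contains $X$. Then every non-associative $K$-algebra $A$ that is generated by a countable (finite or countably infinite) subset embeds into a non-associative $K$-algebra generated by two elements: there are a non-associative $K$-algebra $B$, an injective $K$-linear multiplicative map $A\to B$, and elements $a,b\in B$ such that $\{a,b\}$ generates $B$. -/

import Mathlib

universe w u v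

/-!
Let `x 0, x 1, …` enumerate generators of `A`. No identities are imposed on the larger algebra, so
any bilinear product on a module containing `A` is allowed. On `A × K[X] × K` the product is
`(x, p, c) * (y, q, d) = (x * y + d • φ p, X * p * q, 0)`, where `φ : K[X] → A` is the linear map
with `φ (X ^ n) = x n`. The first factor is a copy of `A`. With `a = (0, 1, 0)` and
`b = (0, 0, 1)`, multiplying on the right by `a` turns `(0, X ^ n, 0)` into `(0, X ^ (n + 1), 0)`,
so `a` generates all powers of `X`, and multiplying on the right by `b` turns `(0, X ^ n, 0)` into
`(x n, 0, 0)`. Hence `a` and `b` generate everything.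
-/

open Polynomial

noncomputable section TwoGenExtension

variable {K : Type u} [CommRing K] {A : Type v} [NonUnitalNonAssocRing A] [Module K A]

/-- The module `A × K[X] × K`, as a type synonym that depends on the linear map `φ : K[X] → A`
used to define its multiplication. -/
def TwoGenExtension (_φ : K[X] →ₗ[K] A) : Type (max u v) := A × K[X] × K

namespace TwoGenExtension

variable (φ : K[X] →ₗ[K] A)

instance : AddCommGroup (TwoGenExtension φ) := inferInstanceAs (AddCommGroup (A × K[X] × K))

instance : Module K (TwoGenExtension φ) := inferInstanceAs (Module K (A × K[X] × K))

/-- The multiplication `(x, p, c) * (y, q, d) = (x * y + d • φ p, X * p * q, 0)`. The factor `X`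
makes the powers of `X`, including `X ^ 0`, reachable from `1`. -/
instance : Mul (TwoGenExtension φ) :=
  ⟨fun s t => (s.1 * t.1 + t.2.2 • φ s.2.1, X * s.2.1 * t.2.1, 0)⟩

variable {φ}

/-- The element of `TwoGenExtension φ` with the given components. -/
def mk (x : A) (p : K[X]) (c : K) : TwoGenExtension φ := (x, p, c)

theorem mk_add (x y : A) (p q : K[X]) (c d : K) :
    (mk x p c + mk y q d : TwoGenExtension φ) = mk (x + y) (p + q) (c + d) := rfl

theorem smul_mk (r : K) (x : A) (p : K[X]) (c : K) :
    (r • mk x p c : TwoGenExtension φ) = mk (r • x) (r • p) (r * c) := rfl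

theorem mk_zero : (mk 0 0 0 : TwoGenExtension φ) = 0 := rfl

theorem mk_mul (x y : A) (p q : K[X]) (c d : K) :
    (mk x p c * mk y q d : TwoGenExtension φ) = mk (x * y + d • φ p) (X * p * q) 0 := rfl

theorem exists_eq_mk (s : TwoGenExtension φ) : ∃ x p c, s = mk x p c := ⟨s.1, s.2.1, s.2.2, rfl⟩

variable (φ) in
instance : NonUnitalNonAssocRing (TwoGenExtension φ) where
  left_distrib s t r := by
    obtain ⟨x, p, c, rfl⟩ := s.exists_eq_mk
    obtain ⟨y, q, d, rfl⟩ := t.exists_eq_mk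
    obtain ⟨z, r, e, rfl⟩ := r.exists_eq_mk
    simp only [mk_add, mk_mul, mul_add, add_smul, add_zero]
    congr 1
    abel
  right_distrib s t r := by
    obtain ⟨x, p, c, rfl⟩ := s.exists_eq_mk
    obtain ⟨y, q, d, rfl⟩ := t.exists_eq_mk
    obtain ⟨z, r, e, rfl⟩ := r.exists_eq_mk
    simp only [mk_add, mk_mul, mul_add, add_mul, map_add, smul_add, add_zero]
    congr 1
    abel
  zero_mul s := by
    obtain ⟨x, p, c, rfl⟩ := s.exists_eq_mk
    simp [← mk_zero, mk_mul]
  mul_zero s := by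
    obtain ⟨x, p, c, rfl⟩ := s.exists_eq_mk
    simp [← mk_zero, mk_mul]

instance [IsScalarTower K A A] : IsScalarTower K (TwoGenExtension φ) (TwoGenExtension φ) where
  smul_assoc r s t := by
    obtain ⟨x, p, c, rfl⟩ := s.exists_eq_mk
    obtain ⟨y, q, d, rfl⟩ := t.exists_eq_mk
    simp [smul_eq_mul, smul_mk, mk_mul, smul_mul_assoc, smul_comm r d]

instance [SMulCommClass K A A] : SMulCommClass K (TwoGenExtension φ) (TwoGenExtension φ) where
  smul_comm r s t := by
    obtain ⟨x, p, c, rfl⟩ := s.exists_eq_mk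
    obtain ⟨y, q, d, rfl⟩ := t.exists_eq_mk
    simp [smul_eq_mul, smul_mk, mk_mul, mul_smul_comm, mul_smul]

variable (φ) in
/-- The embedding of `A` as the first factor. -/
def inl : A →ₙₐ[K] TwoGenExtension φ where
  toFun x := mk x 0 0
  map_smul' r x := by simp [smul_mk]
  map_zero' := rfl
  map_add' x y := by simp [mk_add]
  map_mul' x y := by simp [mk_mul]

theorem inl_apply (x : A) : inl φ x = mk x 0 0 := rfl

theorem inl_injective : Function.Injective (inl φ) := fun _ _ h => congrArg Prod.fst h

theorem adjoin_pair_eq_top [IsScalarTower K A A] [SMulCommClass K A A]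
    (h : NonUnitalAlgebra.adjoin K (Set.range fun n : ℕ => φ (X ^ n)) = ⊤) :
    NonUnitalAlgebra.adjoin K ({mk 0 1 0, mk 0 0 1} : Set (TwoGenExtension φ)) = ⊤ := by
  set S := NonUnitalAlgebra.adjoin K ({mk 0 1 0, mk 0 0 1} : Set (TwoGenExtension φ))
  have ha : mk 0 1 0 ∈ S := NonUnitalAlgebra.subset_adjoin K (by simp)
  have hb : mk 0 0 1 ∈ S := NonUnitalAlgebra.subset_adjoin K (by simp)
  have hpow (n : ℕ) : mk 0 (X ^ n) 0 ∈ S := by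
    induction n with
    | zero => simpa using ha
    | succ n ih => simpa [mk_mul, pow_succ'] using mul_mem ih ha
  have hpoly (p : K[X]) : mk 0 p 0 ∈ S := by
    induction p using Polynomial.induction_on' with
    | add p q hp hq => simpa [mk_add] using add_mem hp hq
    | monomial n r =>
      simpa [smul_mk, smul_X_eq_monomial] using S.smul_mem r (hpow n)
  have hinl (x : A) : inl φ x ∈ S := by
    have hle : NonUnitalAlgebra.adjoin K (Set.range fun n : ℕ => φ (X ^ n)) ≤ S.comap (inl φ) := by
      refine NonUnitalAlgebra.adjoin_le ?_
      rintro _ ⟨n, rfl⟩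
      change inl φ _ ∈ S
      simpa [inl_apply, mk_mul] using mul_mem (hpow n) hb
    exact hle (h ▸ NonUnitalAlgebra.mem_top)
  refine eq_top_iff.2 fun s _ => ?_
  obtain ⟨x, p, c, rfl⟩ := s.exists_eq_mk
  simpa [inl_apply, mk_add, smul_mk] using
    add_mem (add_mem (hinl x) (hpoly p)) (S.smul_mem c hb)

end TwoGenExtension

end TwoGenExtension

/-- Algebras over `K` are bilinear, not necessarily associative and not necessarily unital: a
`NonUnitalNonAssocRing` with a `K`-module structure such that `(r • x) * y = r • (x * y)`
(`IsScalarTower`) and `x * (r • y) = r • (x * y)` (`SMulCommClass`). -/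
theorem theorem3p1 {k : Type w} [Field k] {K : Type u} [CommRing K] [Algebra k K]
    {A : Type v} [NonUnitalNonAssocRing A] [Module K A] [IsScalarTower K A A]
    [SMulCommClass K A A]
    (hA : ∃ X : Set A, X.Countable ∧ NonUnitalAlgebra.adjoin K X = ⊤) :
    ∃ (B : Type (max u v)) (_ : NonUnitalNonAssocRing B) (_ : Module K B)
      (_ : IsScalarTower K B B) (_ : SMulCommClass K B B) (f : A →ₙₐ[K] B),
      Function.Injective f ∧
        ∃ a b : B, NonUnitalAlgebra.adjoin K ({a, b} : Set B) = ⊤ := by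
  obtain ⟨Y, hY, hgen⟩ := hA
  -- Adding `0` to `Y` makes it nonempty, so that a sequence can enumerate it.
  obtain ⟨x, hx⟩ := (hY.insert 0).exists_eq_range (Set.insert_nonempty 0 Y)
  let φ : K[X] →ₗ[K] A := (basisMonomials K).constr K x
  have hφ (n : ℕ) : φ (X ^ n) = x n := by
    rw [X_pow_eq_monomial, ← congrFun (coe_basisMonomials K) n]
    exact (basisMonomials K).constr_basis K x n
  refine ⟨TwoGenExtension φ, inferInstance, inferInstance, inferInstance, inferInstance,
    TwoGenExtension.inl φ, TwoGenExtension.inl_injective, _, _,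
    TwoGenExtension.adjoin_pair_eq_top ?_⟩
  simp only [hφ]
  refine eq_top_iff.2 (hgen ▸ NonUnitalAlgebra.adjoin_mono ?_)
  rw [← hx]
  exact Set.subset_insert 0 Y
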